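/- **Baker's inequality.** Let $\mathbf C_v$ be either the field $\mathbf C$ of complex numbers or the field $\mathbf C_p$ for a prime number $p$, with absolute value $|\cdot|$. Let $d\ge 2$ and let $U,V\in\mathbf C_v[X,Y]$ be homogeneous polynomials of degree $d$ without common zero in $\mathbf C_v^2$ other than $(0,0)$. Put $(U_0,V_0)=(X,Y)$ and $U_{k+1}=U(U_k,V_k)$, $V_{k+1}=V(U_k,V_k)$. Then for every $(x,y)\in\mathbf C_v^2\setminus\{(0,0)\}$ the limit $$\Lambda_v(x,y)=\lim_{k\to\infty}\frac1{d^k}\log\max\bigl(|U_k(x,y)|,|V_k(x,y)|\bigr)$$ exists in $\mathbf R$, and for two distinct points $P_1=[x_1:y_1]$, $P_2=[x_2:y_2]$ of $\mathbf P^1(\mathbf C_v)$ the real number $$G_v(P_1,P_2)=-\log|x_1y_2-x_2y_1|+\Lambda_v(x_1,y_1)+\Lambda_v(x_2,y_2)-\frac1{d(d-1)}\log|\operatorname{Res}(U,V)|$$ does not depend on the choice of the homogeneous coordinates; here $\operatorname{Res}(U,V)$ is the resultant of the two binary forms $U,V$ of degree $d$ (the $2d\times 2d$ Sylvester determinant).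 There is a real number $c_v$ (depending on $\mathbf C_v,U,V$) such that for every integer $n\ge2$ and every family $(P_1,\dots,P_n)$ of distinct points of $\mathbf P^1(\mathbf C_v)$, $$\frac1{n(n-1)}\sum_{\substack{i,j=1\\ i\ne j}}^n G_v(P_i,P_j)\ \ge\ -c_v\,\frac{\log n}{n}.$$ In particular, $$\liminf_{\substack{n\to\infty\\ (P_1,\dots,P_n)\ \text{distinct}}}\ \frac1{n(n-1)}\sum_{\substack{i,j=1\\ i\ne j}}^n G_v(P_i,P_j)\ \ge\ 0 .$$ -/

import Mathlib

open Filter Topology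

noncomputable section

namespace DynGreen

/-- `K` is, as a field with absolute value, the field of complex numbers or the field
`ℂ_p` of `p`-adic complex numbers for some prime number `p`. -/
def IsComplexOrPadic (K : Type*) [NormedField K] : Prop :=
  (∃ e : K ≃+* ℂ, ∀ x : K, ‖e x‖ = ‖x‖) ∨
    ∃ (p : ℕ) (_ : Fact p.Prime), ∃ e : K ≃+* PadicComplex p, ∀ x : K, ‖e x‖ = ‖x‖

variable {K : Type*} [NormedField K]

/-- The pair `(U_k, V_k)` of polynomials in the two variables `X = X 0` and `Y = X 1` that gives the
`k`-th iterate: `(U_0, V_0) = (X, Y)`, `U_{k+1} = U(U_k, V_k)` and `V_{k+1} = V(U_k, V_k)`. -/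
def iter (U V : MvPolynomial (Fin 2) K) :
    ℕ → MvPolynomial (Fin 2) K × MvPolynomial (Fin 2) K
  | 0 => (MvPolynomial.X 0, MvPolynomial.X 1)
  | k + 1 =>
    (MvPolynomial.bind₁ ![(iter U V k).1, (iter U V k).2] U,
      MvPolynomial.bind₁ ![(iter U V k).1, (iter U V k).2] V)

/-- `d^{-k} log max(|U_k(z)|, |V_k(z)|)`. -/
def escapeSeq (d : ℕ) (U V : MvPolynomial (Fin 2) K) (z : Fin 2 → K) (k : ℕ) : ℝ :=
  1 / (d : ℝ) ^ k *
    Real.log (max ‖MvPolynomial.eval z (iter U V k).1‖ ‖MvPolynomial.eval z (iter U V k).2‖)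

/-- The homogeneous escape function `Λ(z) = lim_k d^{-k} log max(|U_k(z)|, |V_k(z)|)`
(meaningful for `z ≠ 0`). -/
def escape (d : ℕ) (U V : MvPolynomial (Fin 2) K) (z : Fin 2 → K) : ℝ :=
  limUnder atTop (escapeSeq d U V z)

/-- The resultant of two binary forms `U`, `V` of degree `d`: the determinant of the `2d × 2d`
Sylvester matrix, whose columns are the coefficients of `X^j Y^(d-1-j) V` and `X^j Y^(d-1-j) U`
for `j < d`. The coefficients of a form are read off after setting `Y = 1`. -/
def res (d : ℕ) (U V : MvPolynomial (Fin 2) K) : K :=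
  Polynomial.resultant (MvPolynomial.aeval ![Polynomial.X, (1 : Polynomial K)] U)
    (MvPolynomial.aeval ![Polynomial.X, (1 : Polynomial K)] V) d d

/-- The Green function in terms of homogeneous coordinates `z = (x₁, y₁)` and `w = (x₂, y₂)`. -/
def greenCoord (d : ℕ) (U V : MvPolynomial (Fin 2) K) (z w : Fin 2 → K) : ℝ :=
  -Real.log ‖Matrix.det !![z 0, z 1; w 0, w 1]‖ + escape d U V z + escape d U V w
    - 1 / ((d : ℝ) * ((d : ℝ) - 1)) * Real.log ‖res d U V‖

/-- The normalized dynamical Green function on pairs of distinct points of `ℙ¹(K)`. -/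
def green (d : ℕ) (U V : MvPolynomial (Fin 2) K)
    (P Q : Projectivization K (Fin 2 → K)) : ℝ :=
  greenCoord d U V P.rep Q.rep

/-- The average of the Green function over the ordered pairs of distinct indices. -/
def avgGreen (d : ℕ) (U V : MvPolynomial (Fin 2) K) {n : ℕ}
    (P : Fin n → Projectivization K (Fin 2 → K)) : ℝ :=
  1 / ((n : ℝ) * ((n : ℝ) - 1)) *
    ∑ i : Fin n, ∑ j : Fin n with i ≠ j, green d U V (P i) (P j)

end DynGreen

end

/-! For `n = d ^ k`, the forms of degree `n - 1` have, besides the monomials, a family adapted to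
the map `φ = (U, V)`: products of coordinates of `z, φ z, ..., φ^[k-1] z`, with exponents read from
base-`d` digits. The change of basis has determinant a power of the resultant (`det_powerMatrix`,
`exists_coeff_iterateBasis`), so evaluation at `n` points gives that power times the projective
Vandermonde product (`det_iterateBasis`).

On the other hand `log ‖φ^[i] z‖` differs from `d ^ i * Λ(z)` by at most a constant, so the Leibniz
expansion bounds this determinant by `n!` times the exponential of `(n - 1) * ∑ Λ(z_i) + O(n log
n)`. Taking logarithms gives the inequality for `n = d ^ k` (`le_sum_greenCoord`); the power of the
resultant accounts for the normalizing term of `G_v`, up to `O(n log n)`.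

A lower bound for the average over all `m`-point families persists for larger families
(`le_sum_sum_of_card_le`). Applying this with `m = d ^ k ≤ n < d ^ (k + 1)` costs only a bounded
factor. -/

namespace DynGreen

/-! ### Resultants and the determinant of the forms `X^a Y^(d-1-a) F^b G^(M-b)`. -/

section Algebra

open Polynomial

variable {R : Type*} [CommRing R]

/-- Multiplicativity of the resultant for formal degrees that need not be attained. -/
lemma resultant_mul_right_of_le (f g h : R[X]) (m n k : ℕ) (hf : f.natDegree ≤ m)
    (hg : g.natDegree ≤ n) (hh : h.natDegree ≤ k) :
    resultant f (g * h) m (n + k) = resultant f g m n * resultant f h m k := by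
  obtain ⟨a, rfl⟩ := le_iff_exists_add.mp hg
  obtain ⟨b, rfl⟩ := le_iff_exists_add.mp hh
  rw [show g.natDegree + a + (h.natDegree + b) = g.natDegree + h.natDegree + (a + b) by ring,
    resultant_add_right_deg _ _ _ _ _ natDegree_mul_le, resultant_mul_right _ _ _ _ hf,
    resultant_add_right_deg _ _ _ _ _ le_rfl, resultant_add_right_deg _ _ _ _ _ le_rfl]
  ring

lemma resultant_pow_right_of_le (f g : R[X]) (m n k : ℕ) (hf : f.natDegree ≤ m)
    (hg : g.natDegree ≤ n) :
    resultant f (g ^ k) m (n * k) = resultant f g m n ^ k := by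
  induction k with
  | zero => simp
  | succ k ih =>
    have hk : (g ^ k).natDegree ≤ n * k :=
      natDegree_pow_le.trans (by rw [mul_comm]; exact Nat.mul_le_mul_right _ hg)
    rw [pow_succ, pow_succ, mul_add_one, resultant_mul_right_of_le _ _ _ _ _ _ hf hk hg, ih]

lemma sylvester_castAdd (f g : R[X]) (m n : ℕ) (hg : g.natDegree ≤ n) (i : Fin (m + n))
    (j : Fin m) : sylvester f g m n i (j.castAdd n) = (X ^ (j : ℕ) * g).coeff i := by
  simp only [sylvester, Matrix.of_apply, Fin.addCases_left, coeff_X_pow_mul', Set.mem_Icc]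
  split_ifs with h1 h2 h2
  · rfl
  · omega
  · exact (coeff_eq_zero_of_natDegree_lt (by omega)).symm
  · rfl

lemma sylvester_natAdd (f g : R[X]) (m n : ℕ) (hf : f.natDegree ≤ m) (i : Fin (m + n))
    (j : Fin n) : sylvester f g m n i (j.natAdd m) = (X ^ (j : ℕ) * f).coeff i := by
  simp only [sylvester, Matrix.of_apply, Fin.addCases_right, coeff_X_pow_mul', Set.mem_Icc]
  split_ifs with h1 h2 h2
  · rfl
  · omega
  · exact (coeff_eq_zero_of_natDegree_lt (by omega)).symm
  · rfl

/-- The polynomials `X ^ a * f ^ b * g ^ (M - b)`, where `j = a + d * b` with `a < d`. -/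
noncomputable def powerFamily (d M : ℕ) (f g : R[X]) (j : ℕ) : R[X] :=
  X ^ (j % d) * f ^ (j / d) * g ^ (M - j / d)

lemma natDegree_powerFamily_lt {d M : ℕ} {f g : R[X]} (hf : f.natDegree ≤ d)
    (hg : g.natDegree ≤ d) {j : ℕ} (hj : j < d * (M + 1)) :
    (powerFamily d M f g j).natDegree < d * (M + 1) := by
  have hd : 0 < d := Nat.pos_of_ne_zero (by rintro rfl; simp at hj)
  have hb : j / d ≤ M := Nat.lt_succ_iff.mp (Nat.div_lt_of_lt_mul hj)
  have h1 : (X ^ (j % d) : R[X]).natDegree ≤ j % d := natDegree_X_pow_le _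
  have h2 : (f ^ (j / d)).natDegree ≤ j / d * d :=
    natDegree_pow_le.trans (Nat.mul_le_mul_left _ hf)
  have h3 : (g ^ (M - j / d)).natDegree ≤ (M - j / d) * d :=
    natDegree_pow_le.trans (Nat.mul_le_mul_left _ hg)
  have h4 : j / d * d + (M - j / d) * d = M * d := by rw [← add_mul]; congr 1; omega
  calc (powerFamily d M f g j).natDegree
      ≤ j % d + j / d * d + (M - j / d) * d :=
        natDegree_mul_le_of_le (natDegree_mul_le_of_le h1 h2) h3
    _ < d * (M + 1) := by
        have := Nat.mod_lt j hd
        rw [add_assoc, h4, mul_comm d, add_mul, one_mul]; omega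

lemma powerFamily_of_lt {d M : ℕ} (f g : R[X]) {j : ℕ} (hj : j < d) :
    powerFamily d M f g j = X ^ j * g ^ M := by
  simp [powerFamily, Nat.mod_eq_of_lt hj, Nat.div_eq_of_lt hj]

lemma powerFamily_add {d M : ℕ} (hd : 0 < d) (f g : R[X]) (j : ℕ) :
    powerFamily d (M + 1) f g (d + j) = f * powerFamily d M f g j := by
  simp only [powerFamily, Nat.add_mod_left, Nat.add_div_left _ hd, pow_succ,
    Nat.add_sub_add_right]
  ring

/-- The matrix of coefficients of `powerFamily d M f g`. -/
noncomputable def powerMatrix (d M : ℕ) (f g : R[X]) : Matrix (Fin (d * (M + 1))) (Fin (d * (M + 1))) R :=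
  .of fun i j ↦ (powerFamily d M f g j).coeff i

/-- For `M + 1`, the first `d` members are `X ^ j * g ^ (M + 1)` and the others are `f` times the
family for `M`. Hence the matrix is the Sylvester matrix of `f` and `g ^ (M + 1)` times a block
diagonal matrix, and each step contributes `M + 1` factors of the resultant. -/
lemma det_powerMatrix {d : ℕ} (hd : 0 < d) (f g : R[X]) (hf : f.natDegree ≤ d)
    (hg : g.natDegree ≤ d) (M : ℕ) :
    (powerMatrix d M f g).det = resultant f g d d ^ (M * (M + 1) / 2) := by
  induction M with
  | zero =>
    have : powerMatrix d 0 f g = 1 := by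
      ext i j
      have hj : (j : ℕ) < d := by have := j.2; omega
      simp [powerMatrix, powerFamily_of_lt _ _ hj, coeff_X_pow, Matrix.one_apply, Fin.ext_iff]
    simp [this]
  | succ M ih =>
    have hdeg : (g ^ (M + 1)).natDegree ≤ d * (M + 1) :=
      natDegree_pow_le.trans (by rw [mul_comm]; exact Nat.mul_le_mul_right _ hg)
    have key : (powerMatrix d (M + 1) f g).reindex (finCongr (by ring)) (finCongr (by ring)) =
        sylvester f (g ^ (M + 1)) d (d * (M + 1)) *
          (Matrix.fromBlocks 1 0 0 (powerMatrix d M f g)).reindex finSumFinEquiv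
            finSumFinEquiv := by
      ext i j
      rw [Matrix.mul_apply, ← finSumFinEquiv.sum_comp]
      obtain ⟨j, rfl⟩ := finSumFinEquiv.surjective j
      rcases j with j | j
      · simp [powerMatrix, powerFamily_of_lt, sylvester_castAdd _ _ _ _ hdeg, Matrix.one_apply]
      · simp only [powerMatrix, Matrix.reindex_apply, Matrix.submatrix_apply, Matrix.of_apply,
          Fintype.sum_sum_type, finSumFinEquiv_apply_left, finSumFinEquiv_apply_right,
          sylvester_natAdd _ _ _ _ hf, finCongr_symm, finCongr_apply_coe, Fin.val_natAdd,
          powerFamily_add hd, finSumFinEquiv_symm_apply_castAdd, finSumFinEquiv_symm_apply_natAdd,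
          Matrix.fromBlocks_apply₁₂, Matrix.fromBlocks_apply₂₂, Matrix.zero_apply, mul_zero,
          Finset.sum_const_zero, zero_add]
        conv_lhs => rw [(powerFamily d M f g j).as_sum_range' (d * (M + 1))
          (natDegree_powerFamily_lt hf hg j.2)]
        rw [Finset.mul_sum, finsetSum_coeff, Finset.sum_range]
        refine Finset.sum_congr rfl fun l _ ↦ ?_
        rw [← C_mul_X_pow_eq_monomial, ← mul_assoc, mul_comm f, mul_assoc, coeff_C_mul,
          mul_comm f, mul_comm]
    rw [← Matrix.det_reindex_self (finCongr (by ring : d * (M + 1 + 1) = d + d * (M + 1))), key, Matrix.det_mul,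
      Matrix.det_reindex_self, Matrix.det_fromBlocks_zero₂₁, Matrix.det_one, one_mul, ih,
      ← resultant, resultant_pow_right_of_le _ _ _ _ _ hf hg, ← pow_add]
    congr 1
    have : (M + 1) * (M + 1 + 1) = M * (M + 1) + (M + 1) * 2 := by ring
    rw [this, Nat.add_mul_div_right _ _ two_pos, add_comm]

lemma eval_homogenize_eq_sum (p : R[X]) (n : ℕ) (z : Fin 2 → R) :
    MvPolynomial.eval z (p.homogenize n) =
      ∑ i : Fin (n + 1), z 0 ^ (i : ℕ) * z 1 ^ (n - i) * p.coeff i := by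
  rw [homogenize, MvPolynomial.eval_sum, Finset.Nat.sum_antidiagonal_eq_sum_range_succ_mk,
    Finset.sum_range]
  refine Finset.sum_congr rfl fun i _ ↦ ?_
  rw [MvPolynomial.eval_monomial, Finsupp.update_eq_add_single (by simp),
    Finsupp.prod_add_index' (by simp) (by simp [pow_add]), Finsupp.prod_single_index (by simp),
    Finsupp.prod_single_index (by simp), mul_comm]

/-- Homogenizing a member of `powerFamily` in degree `d * (M + 1) - 1` acts factor by factor; the
factor `X ^ (j % d)` is given formal degree `d - 1`. -/
lemma eval_pow_mul_pow_mul_pow {d M : ℕ} {f g : R[X]} (hf : f.natDegree ≤ d)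
    (hg : g.natDegree ≤ d) (z : Fin 2 → R) (j : Fin (d * (M + 1))) :
    z 0 ^ (j % d : ℕ) * z 1 ^ (d - 1 - j % d : ℕ) *
        MvPolynomial.eval z (f.homogenize d) ^ (j / d : ℕ) *
        MvPolynomial.eval z (g.homogenize d) ^ (M - j / d : ℕ) =
      ∑ i : Fin (d * (M + 1)), z 0 ^ (i : ℕ) * z 1 ^ (d * (M + 1) - 1 - i) *
        powerMatrix d M f g i j := by
  have hd : 0 < d := Nat.pos_of_ne_zero (by rintro rfl; have := j.2; simp at this)
  have hb : (j : ℕ) / d ≤ M := Nat.lt_succ_iff.mp (Nat.div_lt_of_lt_mul j.2)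
  have hpow (p : R[X]) (hp : p.natDegree ≤ d) (k : ℕ) :
      (p ^ k).homogenize (k * d) = p.homogenize d ^ k := by
    have := homogenize_finsetProd (s := Finset.range k) (p := fun _ ↦ p) (n := fun _ ↦ d)
      (fun _ _ ↦ hp)
    simpa using this
  have h1 : (X ^ (j % d : ℕ) : R[X]).natDegree ≤ d - 1 :=
    (natDegree_X_pow_le _).trans (by have := Nat.mod_lt j hd; omega)
  have h2 : (f ^ (j / d : ℕ)).natDegree ≤ j / d * d :=
    natDegree_pow_le.trans (Nat.mul_le_mul_left _ hf)
  have h3 : (g ^ (M - j / d : ℕ)).natDegree ≤ (M - j / d) * d :=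
    natDegree_pow_le.trans (Nat.mul_le_mul_left _ hg)
  have h4 : (j / d * d + (M - j / d) * d : ℕ) = M * d := by rw [← add_mul]; congr 1; omega
  have h5 : d - 1 + j / d * d + (M - j / d) * d = d * (M + 1) - 1 := by
    rw [add_assoc, h4, mul_comm d, add_mul, one_mul]; omega
  have hN : d * (M + 1) - 1 + 1 = d * (M + 1) := Nat.sub_add_cancel (Nat.mul_pos hd M.succ_pos)
  have key : (powerFamily d M f g j).homogenize (d * (M + 1) - 1) =
      (MvPolynomial.X 0 ^ (j % d : ℕ) * MvPolynomial.X 1 ^ (d - 1 - j % d : ℕ)) *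
        f.homogenize d ^ (j / d : ℕ) * g.homogenize d ^ (M - j / d : ℕ) := by
    rw [powerFamily, ← h5, homogenize_mul _ _ (natDegree_mul_le_of_le h1 h2) h3,
      homogenize_mul _ _ h1 h2, hpow _ hf, hpow _ hg,
      homogenize_X_pow (by have := Nat.mod_lt j hd; omega)]
  have := congrArg (MvPolynomial.eval z) key
  rw [eval_homogenize_eq_sum] at this
  simp only [map_mul, map_pow, MvPolynomial.eval_X] at this
  rw [← this, ← (finCongr hN).sum_comp]
  rfl

end Algebra

/-! ### The basis built from iterates, and nonvanishing of the resultant. -/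

section Basis

open Polynomial

variable {K : Type*} [Field K]

/-- Products of the coordinates of the iterates of `φ`, indexed by the digits of `j` in base `d`;
for a form `φ` of degree `d` these are forms of degree `d ^ k - 1`. -/
def iterateBasis (d : ℕ) (φ : (Fin 2 → K) → Fin 2 → K) : ℕ → ℕ → (Fin 2 → K) → K
  | 0, _, _ => 1
  | k + 1, j, z => z 0 ^ (j % d) * z 1 ^ (d - 1 - j % d) * iterateBasis d φ k (j / d) (φ z)

/-- The exponent of the resultant in the determinant of `iterateBasis`. -/
def resExponent (d : ℕ) : ℕ → ℕ
  | 0 => 0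
  | k + 1 => d * resExponent d k + (d ^ k - 1) * d ^ k / 2

/-- With `n = d ^ k`, the first term matches the resultant term of the Green function summed over `n
* (n - 1)` pairs; the second is only `O(n log n)`. -/
lemma two_mul_resExponent {d : ℕ} (hd : 2 ≤ d) (k : ℕ) :
    2 * (resExponent d k : ℝ) =
      (d : ℝ) ^ k * ((d : ℝ) ^ k - 1) / (d * (d - 1)) - (d : ℝ) ^ k * k / d := by
  have h2 : (2 : ℝ) ≤ d := by exact_mod_cast hd
  have h0 : (d : ℝ) ≠ 0 := by linarith
  have h1 : (d : ℝ) - 1 ≠ 0 := by linarith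
  induction k with
  | zero => simp [resExponent]
  | succ k ih =>
    have hpos : 1 ≤ d ^ k := Nat.one_le_pow _ _ (by omega)
    have hdvd : 2 ∣ (d ^ k - 1) * d ^ k := by
      have := Nat.even_mul_succ_self (d ^ k - 1)
      rw [Nat.sub_add_cancel hpos] at this
      exact this.two_dvd
    have hc : (((d ^ k - 1) * d ^ k / 2 : ℕ) : ℝ) = ((d : ℝ) ^ k - 1) * (d : ℝ) ^ k / 2 := by
      rw [Nat.cast_div hdvd (by norm_num)]
      push_cast [Nat.cast_sub hpos]
      ring
    rw [resExponent, Nat.cast_add, Nat.cast_mul, hc, mul_add, mul_left_comm, ih]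
    push_cast
    field_simp
    ring

/-- Substituting `φ z` into the level-`k` expansion turns monomials into products of powers of `F`
and `G`, and the last digit supplies the remaining factor. The new coefficient matrix is thus
`powerMatrix` times `C ⊗ 1`, whose Kronecker factor has determinant `C.det ^ d`. -/
lemma exists_coeff_iterateBasis {d : ℕ} (hd : 0 < d) (f g : K[X]) (hf : f.natDegree ≤ d)
    (hg : g.natDegree ≤ d) (φ : (Fin 2 → K) → Fin 2 → K)
    (hφ : ∀ z, φ z = ![MvPolynomial.eval z (f.homogenize d), MvPolynomial.eval z (g.homogenize d)])
    (k : ℕ) : ∀ n, n = d ^ k → ∃ C : Matrix (Fin n) (Fin n) K,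
      C.det = resultant f g d d ^ resExponent d k ∧
      ∀ (z : Fin 2 → K) (j : Fin n), iterateBasis d φ k j z =
        ∑ i : Fin n, z 0 ^ (i : ℕ) * z 1 ^ (n - 1 - i) * C i j := by
  induction k with
  | zero =>
    intro n hn
    obtain rfl : n = 1 := by simpa using hn
    exact ⟨1, by simp [resExponent], fun z j ↦ by
      obtain rfl : j = 0 := Subsingleton.elim _ _
      simp [iterateBasis]⟩
  | succ k ih =>
    rintro n hn
    obtain ⟨M, hM⟩ : ∃ M, d ^ k = M + 1 := ⟨d ^ k - 1, by
      have := Nat.one_le_pow k d hd; omega⟩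
    obtain ⟨C, hC, hb⟩ := ih (M + 1) hM.symm
    obtain rfl : n = d * (M + 1) := by rw [hn, pow_succ, hM, mul_comm]
    let e : Fin (M + 1) × Fin d ≃ Fin (d * (M + 1)) :=
      finProdFinEquiv.trans (finCongr (mul_comm _ _))
    have he (c : Fin (M + 1)) (a : Fin d) : (e (c, a) : ℕ) = a + d * c := rfl
    have hmod (c : Fin (M + 1)) (a : Fin d) : (e (c, a) : ℕ) % d = a := by
      rw [he, Nat.add_mul_mod_self_left, Nat.mod_eq_of_lt a.2]
    have hdiv (c : Fin (M + 1)) (a : Fin d) : (e (c, a) : ℕ) / d = c := by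
      rw [he, Nat.add_mul_div_left _ _ hd, Nat.div_eq_of_lt a.2, zero_add]
    refine ⟨powerMatrix d M f g *
      (Matrix.kroneckerMap (· * ·) C (1 : Matrix (Fin d) (Fin d) K)).reindex e e, ?_, fun z j ↦ ?_⟩
    · rw [Matrix.det_mul, Matrix.det_reindex_self, Matrix.det_kronecker, hC, Matrix.det_one,
        det_powerMatrix hd f g hf hg, resExponent, hM, Fintype.card_fin, one_pow, mul_one,
        ← pow_mul, ← pow_add, Nat.add_sub_cancel, add_comm, mul_comm d]
    · obtain ⟨⟨c, a⟩, rfl⟩ := e.surjective j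
      have hP (i : Fin (M + 1)) := eval_pow_mul_pow_mul_pow hf hg z (e (i, a))
      simp only [hmod, hdiv] at hP
      rw [iterateBasis, hmod, hdiv, hb, Finset.mul_sum]
      have hφ0 : φ z 0 = MvPolynomial.eval z (f.homogenize d) := by rw [hφ]; rfl
      have hφ1 : φ z 1 = MvPolynomial.eval z (g.homogenize d) := by rw [hφ]; rfl
      have hrow (l : Fin (d * (M + 1))) : (powerMatrix d M f g *
          (Matrix.kroneckerMap (· * ·) C (1 : Matrix (Fin d) (Fin d) K)).reindex e e) l (e (c, a)) =
            ∑ i, powerMatrix d M f g l (e (i, a)) * C i c := by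
        rw [Matrix.mul_apply, ← e.sum_comp, Fintype.sum_prod_type]
        refine Finset.sum_congr rfl fun i _ ↦ ?_
        simp [Matrix.kroneckerMap_apply, Matrix.one_apply]
      simp only [hrow, Finset.mul_sum]
      rw [Finset.sum_comm]
      refine Finset.sum_congr rfl fun i _ ↦ ?_
      simp only [← mul_assoc, ← Finset.sum_mul]
      rw [← hP i, hφ0, hφ1, Nat.add_sub_cancel]

lemma det_iterateBasis {d : ℕ} (hd : 0 < d) (f g : K[X]) (hf : f.natDegree ≤ d)
    (hg : g.natDegree ≤ d) (φ : (Fin 2 → K) → Fin 2 → K)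
    (hφ : ∀ z, φ z = ![MvPolynomial.eval z (f.homogenize d), MvPolynomial.eval z (g.homogenize d)])
    (k : ℕ) {n : ℕ} (hn : n = d ^ k) (z : Fin n → Fin 2 → K) :
    (Matrix.of fun l j : Fin n ↦ iterateBasis d φ k j (z l)).det =
      resultant f g d d ^ resExponent d k *
        ∏ i : Fin n, ∏ j ∈ Finset.Ioi i, (z j 0 * z i 1 - z i 0 * z j 1) := by
  obtain ⟨C, hC, hb⟩ := exists_coeff_iterateBasis hd f g hf hg φ hφ k n hn
  have : (Matrix.of fun l j : Fin n ↦ iterateBasis d φ k j (z l)) =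
      Matrix.projVandermonde (fun l ↦ z l 0) (fun l ↦ z l 1) * C := by
    ext l j
    rw [Matrix.of_apply, hb, Matrix.mul_apply]
    refine Finset.sum_congr rfl fun i _ ↦ ?_
    rw [Matrix.projVandermonde_apply, Fin.val_rev, Nat.sub_sub, add_comm 1]
  rw [this, Matrix.det_mul, Matrix.det_projVandermonde, hC, mul_comm]

/-- Two polynomials over an algebraically closed field whose homogenizations in degree `d` have no
nontrivial common zero have a nonzero resultant. -/
lemma resultant_ne_zero_of_homogenize [IsAlgClosed K] {d : ℕ} (f g : K[X])
    (hf : f.natDegree ≤ d) (hg : g.natDegree ≤ d)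
    (hfg : ∀ z : Fin 2 → K, MvPolynomial.eval z (f.homogenize d) = 0 →
      MvPolynomial.eval z (g.homogenize d) = 0 → z = 0) :
    resultant f g d d ≠ 0 := by
  have heval (p : K[X]) (hp : p.natDegree ≤ d) (x : K) :
      MvPolynomial.eval ![x, 1] (p.homogenize d) = p.eval x := by
    rw [eval_homogenize hp _ (by simp)]; simp
  have hinf (p : K[X]) : MvPolynomial.eval ![1, 0] (p.homogenize d) = p.coeff d := by
    rw [eval_homogenize_eq_sum, Fin.sum_univ_castSucc, Finset.sum_eq_zero]
    · simp
    · intro i _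
      have : d - (i : ℕ) ≠ 0 := by have := i.2; omega
      simp [this]
  -- The affine points `[x : 1]` give coprimality; the point `[1 : 0]` will exclude a common drop in
  -- degree.
  have hcop : IsCoprime f g := by
    rw [Polynomial.isCoprime_iff_aeval_ne_zero_of_isAlgClosed K K]
    intro x
    by_contra! h
    simp only [coe_aeval_eq_eval] at h
    have := hfg ![x, 1] (by rw [heval _ hf, h.1]) (by rw [heval _ hg, h.2])
    simpa using congrFun this 1
  have haux (p q : K[X]) (hp : p.natDegree ≤ d) (hq : q.natDegree ≤ d) (h : IsCoprime p q)
      (hpd : p.coeff d ≠ 0) : resultant p q d d ≠ 0 := by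
    have hpd' : p.natDegree = d := le_antisymm hp (le_natDegree_of_ne_zero hpd)
    obtain ⟨a, ha⟩ := le_iff_exists_add.mp hq
    have := resultant_add_right_deg p q d q.natDegree a le_rfl
    rw [← ha] at this
    rw [this]
    refine mul_ne_zero (pow_ne_zero _ hpd) ?_
    have := resultant_ne_zero p q h
    rwa [hpd'] at this
  by_cases hfd : f.coeff d = 0
  · have hgd : g.coeff d ≠ 0 := fun hgd ↦ by
      have := hfg ![1, 0] (by rw [hinf, hfd]) (by rw [hinf, hgd])
      simpa using congrFun this 0
    rw [resultant_comm]
    exact mul_ne_zero (pow_ne_zero _ (by simp)) (haux g f hg hf hcop.symm hgd)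
  · exact haux f g hf hg hcop hfd

end Basis

/-! ### Growth of iterates and existence of the escape function. -/

section Escape

variable {K : Type*} [NormedField K]

lemma norm_fin_two (z : Fin 2 → K) : ‖z‖ = max ‖z 0‖ ‖z 1‖ := by
  refine le_antisymm ((pi_norm_le_iff_of_nonneg (by positivity)).mpr fun i ↦ ?_)
    (max_le (norm_le_pi_norm z 0) (norm_le_pi_norm z 1))
  fin_cases i <;> simp

/-- The polynomial map of the plane with coordinates `U` and `V`. -/
noncomputable def pairMap (U V : MvPolynomial (Fin 2) K) (z : Fin 2 → K) : Fin 2 → K :=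
  ![MvPolynomial.eval z U, MvPolynomial.eval z V]

lemma eval_iter (U V : MvPolynomial (Fin 2) K) (k : ℕ) (z : Fin 2 → K) :
    ![MvPolynomial.eval z (iter U V k).1, MvPolynomial.eval z (iter U V k).2] =
      (pairMap U V)^[k] z := by
  induction k with
  | zero => ext i; fin_cases i <;> simp [iter]
  | succ k ih =>
    rw [Function.iterate_succ_apply', ← ih]
    have h (W : MvPolynomial (Fin 2) K) : MvPolynomial.eval z
        (MvPolynomial.bind₁ ![(iter U V k).1, (iter U V k).2] W) =
        MvPolynomial.eval ![MvPolynomial.eval z (iter U V k).1,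
          MvPolynomial.eval z (iter U V k).2] W := by
      rw [← MvPolynomial.coe_aeval_eq_eval, RingHom.coe_coe, MvPolynomial.aeval_bind₁,
        ← MvPolynomial.coe_aeval_eq_eval, RingHom.coe_coe]
      congr 2
      ext i
      fin_cases i <;> simp
    simp only [iter, pairMap, h]

lemma escapeSeq_eq (d : ℕ) (U V : MvPolynomial (Fin 2) K) (z : Fin 2 → K) (k : ℕ) :
    escapeSeq d U V z k = 1 / (d : ℝ) ^ k * Real.log ‖(pairMap U V)^[k] z‖ := by
  rw [← eval_iter, norm_fin_two]
  rfl

lemma iterate_ne_zero {φ : (Fin 2 → K) → Fin 2 → K} (h0 : ∀ z, z ≠ 0 → φ z ≠ 0)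
    {z : Fin 2 → K} (hz : z ≠ 0) (k : ℕ) : φ^[k] z ≠ 0 := by
  induction k with
  | zero => exact hz
  | succ k ih => rw [Function.iterate_succ_apply']; exact h0 _ ih

/-- Consecutive terms differ by at most `C / d ^ (k + 1)`. Summing the geometric tail and
multiplying by `d ^ k` leaves `C / (d - 1) ≤ C`, uniformly in `k` and `z`. -/
lemma exists_tendsto_log_norm_iterate {d : ℕ} (hd : 2 ≤ d) {φ : (Fin 2 → K) → Fin 2 → K} {C : ℝ}
    (h0 : ∀ z, z ≠ 0 → φ z ≠ 0)
    (hC : ∀ z, z ≠ 0 → |Real.log ‖φ z‖ - d * Real.log ‖z‖| ≤ C)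
    {z : Fin 2 → K} (hz : z ≠ 0) :
    ∃ l : ℝ, Tendsto (fun k : ℕ ↦ 1 / (d : ℝ) ^ k * Real.log ‖φ^[k] z‖) atTop (𝓝 l) ∧
      ∀ k : ℕ, |Real.log ‖φ^[k] z‖ - (d : ℝ) ^ k * l| ≤ C := by
  have h2 : (2 : ℝ) ≤ d := by exact_mod_cast hd
  have hd0 : (0 : ℝ) < d := by linarith
  have hC0 : 0 ≤ C := (abs_nonneg _).trans (hC z hz)
  set s : ℕ → ℝ := fun k ↦ 1 / (d : ℝ) ^ k * Real.log ‖φ^[k] z‖ with hs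
  have hstep (k : ℕ) : dist (s k) (s (k + 1)) ≤ C / d * (1 / d) ^ k := by
    have : s k - s (k + 1) = -(1 / (d : ℝ) ^ (k + 1) *
        (Real.log ‖φ (φ^[k] z)‖ - d * Real.log ‖φ^[k] z‖)) := by
      simp only [hs, Function.iterate_succ_apply']
      field_simp
      ring
    rw [Real.dist_eq, this, abs_neg, abs_mul, abs_of_nonneg (by positivity)]
    calc 1 / (d : ℝ) ^ (k + 1) * _ ≤ 1 / (d : ℝ) ^ (k + 1) * C := by
          gcongr; exact hC _ (iterate_ne_zero h0 hz k)
      _ = C / d * (1 / d) ^ k := by rw [one_div_pow, pow_succ]; field_simp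
  have hr : 1 / (d : ℝ) < 1 := by rw [div_lt_one hd0]; linarith
  obtain ⟨l, hl⟩ := cauchySeq_tendsto_of_complete (cauchySeq_of_le_geometric _ _ hr hstep)
  refine ⟨l, hl, fun k ↦ ?_⟩
  have := dist_le_of_le_geometric_of_tendsto _ _ hr hstep hl k
  rw [Real.dist_eq] at this
  have h3 : Real.log ‖φ^[k] z‖ - (d : ℝ) ^ k * l = (d : ℝ) ^ k * (s k - l) := by
    simp only [hs]; field_simp
  rw [h3, abs_mul, abs_of_nonneg (by positivity)]
  calc (d : ℝ) ^ k * |s k - l| ≤ (d : ℝ) ^ k * (C / d * (1 / d) ^ k / (1 - 1 / d)) := by gcongr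
    _ = C / (d - 1) := by
      have : (d : ℝ) - 1 ≠ 0 := by linarith
      rw [one_div_pow]; field_simp
    _ ≤ C := div_le_self hC0 (by linarith)

lemma iterate_smul {d : ℕ} {φ : (Fin 2 → K) → Fin 2 → K}
    (hφ : ∀ (a : K) z, φ (a • z) = a ^ d • φ z) (a : K) (z : Fin 2 → K) (k : ℕ) :
    φ^[k] (a • z) = a ^ d ^ k • φ^[k] z := by
  induction k with
  | zero => simp
  | succ k ih =>
    rw [Function.iterate_succ_apply', ih, hφ, Function.iterate_succ_apply', ← pow_mul, pow_succ]

lemma eval_smul_homogenize (p : Polynomial K) (d : ℕ) (a : K) (z : Fin 2 → K) :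
    MvPolynomial.eval (a • z) (p.homogenize d) = a ^ d * MvPolynomial.eval z (p.homogenize d) := by
  simp only [eval_homogenize_eq_sum, Finset.mul_sum, Pi.smul_apply, smul_eq_mul, mul_pow]
  refine Finset.sum_congr rfl fun i _ ↦ ?_
  have : a ^ d = a ^ (i : ℕ) * a ^ (d - i) := by rw [← pow_add]; congr 1; have := i.2; omega
  rw [this]
  ring

lemma pairMap_homogenize_smul (f g : Polynomial K) (d : ℕ) (a : K) (z : Fin 2 → K) :
    pairMap (f.homogenize d) (g.homogenize d) (a • z) =
      a ^ d • pairMap (f.homogenize d) (g.homogenize d) z := by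
  ext i
  fin_cases i <;> simp [pairMap, eval_smul_homogenize]

lemma norm_eval_homogenize_le (p : Polynomial K) (n : ℕ) (z : Fin 2 → K) :
    ‖MvPolynomial.eval z (p.homogenize n)‖ ≤ (∑ i : Fin (n + 1), ‖p.coeff i‖) * ‖z‖ ^ n := by
  rw [eval_homogenize_eq_sum, Finset.sum_mul]
  refine (norm_sum_le _ _).trans (Finset.sum_le_sum fun i _ ↦ ?_)
  rw [norm_mul, norm_mul, norm_pow, norm_pow, mul_comm]
  gcongr
  calc ‖z 0‖ ^ (i : ℕ) * ‖z 1‖ ^ (n - i) ≤ ‖z‖ ^ (i : ℕ) * ‖z‖ ^ (n - i) := by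
        gcongr <;> exact norm_le_pi_norm z _
    _ = ‖z‖ ^ n := by rw [← pow_add]; congr 1; have := i.2; omega

/-- Effective Nullstellensatz in place of compactness, which fails over `ℂ_p`: inverting the matrix
for `M = 1` writes the monomials of degree `2d - 1` as combinations of `F` and `G` with coefficients
of degree `d - 1`. -/
lemma exists_norm_pow_le {d : ℕ} (hd : 0 < d) (f g : Polynomial K)
    (hf : f.natDegree ≤ d) (hg : g.natDegree ≤ d) (hfg : Polynomial.resultant f g d d ≠ 0) :
    ∃ B : ℝ, ∀ z : Fin 2 → K, ‖z‖ ^ d ≤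
      B * ‖pairMap (f.homogenize d) (g.homogenize d) z‖ := by
  set T := powerMatrix d 1 f g with hT
  have hdet : IsUnit T.det := by
    rw [hT, det_powerMatrix hd f g hf hg]
    simpa using hfg
  set B : ℝ := ∑ i, ∑ j, ‖T⁻¹ i j‖ with hB
  refine ⟨B, fun z ↦ ?_⟩
  set w := pairMap (f.homogenize d) (g.homogenize d) z with hw
  rcases eq_or_ne z 0 with rfl | hz
  · rw [norm_zero, zero_pow hd.ne']; positivity
  have hz' : 0 < ‖z‖ := norm_pos_iff.mpr hz
  let q : Fin (d * (1 + 1)) → K := fun i ↦ z 0 ^ (i : ℕ) * z 1 ^ (d * (1 + 1) - 1 - i)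
  have hq (j) : ‖Matrix.vecMul q T j‖ ≤ ‖z‖ ^ (d - 1) * ‖w‖ := by
    have hj : (j : ℕ) / d < 2 := Nat.div_lt_of_lt_mul j.2
    have hmod := Nat.mod_lt (j : ℕ) hd
    have e : Matrix.vecMul q T j = z 0 ^ (j % d : ℕ) * z 1 ^ (d - 1 - j % d : ℕ) *
        MvPolynomial.eval z (f.homogenize d) ^ (j / d : ℕ) *
        MvPolynomial.eval z (g.homogenize d) ^ (1 - j / d : ℕ) := by
      rw [eval_pow_mul_pow_mul_pow hf hg]; rfl
    have e0 : ‖MvPolynomial.eval z (f.homogenize d)‖ ≤ ‖w‖ := norm_le_pi_norm w 0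
    have e1 : ‖MvPolynomial.eval z (g.homogenize d)‖ ≤ ‖w‖ := norm_le_pi_norm w 1
    rw [e, mul_assoc, norm_mul, norm_mul, norm_mul, norm_pow, norm_pow, norm_pow, norm_pow]
    gcongr
    · calc _ ≤ ‖z‖ ^ (j % d : ℕ) * ‖z‖ ^ (d - 1 - j % d : ℕ) := by
            gcongr <;> exact norm_le_pi_norm z _
        _ = _ := by rw [← pow_add]; congr 1; omega
    · calc _ ≤ ‖w‖ ^ (j / d : ℕ) * ‖w‖ ^ (1 - j / d : ℕ) := by gcongr
        _ = _ := by rw [← pow_add, show (j / d + (1 - j / d) : ℕ) = 1 by omega, pow_one]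
  have hqi (i) : ‖q i‖ ≤ B * (‖z‖ ^ (d - 1) * ‖w‖) := by
    have : q = Matrix.vecMul (Matrix.vecMul q T) T⁻¹ := by
      rw [Matrix.vecMul_vecMul, Matrix.mul_nonsing_inv _ hdet, Matrix.vecMul_one]
    rw [this, Matrix.vecMul, dotProduct, hB, Finset.sum_mul]
    refine (norm_sum_le _ _).trans (Finset.sum_le_sum fun j _ ↦ ?_)
    rw [norm_mul, mul_comm]
    gcongr
    · exact Finset.single_le_sum (f := fun i ↦ ‖T⁻¹ j i‖) (fun _ _ ↦ norm_nonneg _)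
        (Finset.mem_univ i)
    · exact hq j
  -- The pure power of the larger coordinate has norm exactly `‖z‖ ^ (2d - 1)`.
  have hmain : ‖z‖ ^ (d * (1 + 1) - 1) ≤ B * (‖z‖ ^ (d - 1) * ‖w‖) := by
    rw [norm_fin_two z] at hqi ⊢
    rcases max_choice ‖z 0‖ ‖z 1‖ with h | h
    · simpa [q, h, norm_pow] using hqi ⟨d * (1 + 1) - 1, by omega⟩
    · simpa [q, h, norm_pow] using hqi ⟨0, by omega⟩
  have h3 : ‖z‖ ^ (d * (1 + 1) - 1) = ‖z‖ ^ (d - 1) * ‖z‖ ^ d := by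
    rw [← pow_add]; congr 1; omega
  rw [h3, mul_left_comm] at hmain
  exact le_of_mul_le_mul_left hmain (by positivity)

lemma exists_abs_log_norm_pairMap_sub_le {d : ℕ} (hd : 0 < d) (f g : Polynomial K)
    (hf : f.natDegree ≤ d) (hg : g.natDegree ≤ d) (hfg : Polynomial.resultant f g d d ≠ 0) :
    ∃ C : ℝ, ∀ z : Fin 2 → K, z ≠ 0 →
      pairMap (f.homogenize d) (g.homogenize d) z ≠ 0 ∧
      |Real.log ‖pairMap (f.homogenize d) (g.homogenize d) z‖ - d * Real.log ‖z‖| ≤ C := by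
  obtain ⟨B, hB⟩ := exists_norm_pow_le hd f g hf hg hfg
  set A : ℝ := 1 + (∑ i : Fin (d + 1), ‖f.coeff i‖) + ∑ i : Fin (d + 1), ‖g.coeff i‖ with hA
  have hf0 : 0 ≤ ∑ i : Fin (d + 1), ‖f.coeff i‖ := by positivity
  have hg0 : 0 ≤ ∑ i : Fin (d + 1), ‖g.coeff i‖ := by positivity
  have hA0 : 0 < A := by positivity
  refine ⟨|Real.log A| + |Real.log B|, fun z hz ↦ ?_⟩
  set w := pairMap (f.homogenize d) (g.homogenize d) z with hw
  have hz' : 0 < ‖z‖ := norm_pos_iff.mpr hz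
  have hzd : 0 < ‖z‖ ^ d := by positivity
  have hlow := hB z
  have hw0 : w ≠ 0 := by
    intro h
    rw [← hw, h, norm_zero, mul_zero] at hlow
    linarith
  have hw' : 0 < ‖w‖ := norm_pos_iff.mpr hw0
  have hB0 : 0 < B := by
    by_contra! h
    have := mul_nonpos_of_nonpos_of_nonneg h hw'.le
    linarith
  have hup : ‖w‖ ≤ A * ‖z‖ ^ d := by
    rw [norm_fin_two w]
    refine max_le ((norm_eval_homogenize_le f d z).trans ?_)
      ((norm_eval_homogenize_le g d z).trans ?_)
    · gcongr; linarith
    · gcongr; linarith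
  have h1 := Real.log_le_log hw' hup
  have h2 := Real.log_le_log hzd hlow
  rw [Real.log_mul hA0.ne' hzd.ne', Real.log_pow] at h1
  rw [Real.log_mul hB0.ne' hw'.ne', Real.log_pow] at h2
  have h3 := le_abs_self (Real.log A)
  have h4 := le_abs_self (Real.log B)
  have h5 := abs_nonneg (Real.log A)
  have h6 := abs_nonneg (Real.log B)
  exact ⟨hw0, abs_le.mpr ⟨by linarith, by linarith⟩⟩

end Escape

/-! ### Independence of homogeneous coordinates. -/

section Coordinates

variable {K : Type*} [NormedField K]

lemma tendsto_escapeSeq {d : ℕ} (hd : 2 ≤ d) {U V : MvPolynomial (Fin 2) K} {C : ℝ}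
    (hC : ∀ z, z ≠ 0 → pairMap U V z ≠ 0 ∧ |Real.log ‖pairMap U V z‖ - d * Real.log ‖z‖| ≤ C)
    {z : Fin 2 → K} (hz : z ≠ 0) :
    Tendsto (escapeSeq d U V z) atTop (𝓝 (escape d U V z)) ∧
      ∀ k : ℕ, |Real.log ‖(pairMap U V)^[k] z‖ - (d : ℝ) ^ k * escape d U V z| ≤ C := by
  obtain ⟨l, hl, hk⟩ := exists_tendsto_log_norm_iterate hd (fun z hz ↦ (hC z hz).1)
    (fun z hz ↦ (hC z hz).2) hz
  have hl' : Tendsto (escapeSeq d U V z) atTop (𝓝 l) := hl.congr fun k ↦ (escapeSeq_eq ..).symm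
  have : escape d U V z = l := hl'.limUnder_eq
  rw [this]
  exact ⟨hl', hk⟩

lemma escape_smul {d : ℕ} (hd : 2 ≤ d) {U V : MvPolynomial (Fin 2) K} {C : ℝ}
    (hC : ∀ z, z ≠ 0 → pairMap U V z ≠ 0 ∧ |Real.log ‖pairMap U V z‖ - d * Real.log ‖z‖| ≤ C)
    (hs : ∀ (a : K) z, pairMap U V (a • z) = a ^ d • pairMap U V z)
    {z : Fin 2 → K} (hz : z ≠ 0) {a : K} (ha : a ≠ 0) :
    escape d U V (a • z) = Real.log ‖a‖ + escape d U V z := by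
  refine tendsto_nhds_unique (tendsto_escapeSeq hd hC (smul_ne_zero ha hz)).1 ?_
  refine ((tendsto_escapeSeq hd hC hz).1.const_add (Real.log ‖a‖)).congr fun k ↦ ?_
  have hk := iterate_ne_zero (fun z hz ↦ (hC z hz).1) hz k
  have hd0 : (d : ℝ) ≠ 0 := by positivity
  rw [escapeSeq_eq, escapeSeq_eq, iterate_smul hs, norm_smul, norm_pow,
    Real.log_mul (pow_ne_zero _ (norm_ne_zero_iff.mpr ha)) (norm_ne_zero_iff.mpr hk),
    Real.log_pow]
  push_cast
  field_simp

lemma det_ne_zero_of_mk_ne {z w : Fin 2 → K} (hz : z ≠ 0) (hw : w ≠ 0)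
    (h : Projectivization.mk K z hz ≠ Projectivization.mk K w hw) :
    Matrix.det !![z 0, z 1; w 0, w 1] ≠ 0 := by
  rw [Matrix.det_fin_two_of]
  intro h0
  apply h
  rw [Projectivization.mk_eq_mk_iff']
  by_cases hw0 : w 0 = 0
  · have hw1 : w 1 ≠ 0 := fun hw1 ↦ hw (by ext i; fin_cases i <;> simp [hw0, hw1])
    have hz0 : z 0 = 0 := by simpa [hw0, hw1] using h0
    refine ⟨z 1 / w 1, ?_⟩
    ext i; fin_cases i <;> simp [hw0, hz0, hw1]
  · refine ⟨z 0 / w 0, ?_⟩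
    ext i
    fin_cases i
    · simp [hw0]
    · simp only [Fin.mk_one, Pi.smul_apply, smul_eq_mul]
      field_simp
      linear_combination h0

lemma greenCoord_smul_smul {d : ℕ} (hd : 2 ≤ d) {U V : MvPolynomial (Fin 2) K} {C : ℝ}
    (hC : ∀ z, z ≠ 0 → pairMap U V z ≠ 0 ∧ |Real.log ‖pairMap U V z‖ - d * Real.log ‖z‖| ≤ C)
    (hs : ∀ (a : K) z, pairMap U V (a • z) = a ^ d • pairMap U V z)
    {z w : Fin 2 → K} (hz : z ≠ 0) (hw : w ≠ 0)
    (hzw : Matrix.det !![z 0, z 1; w 0, w 1] ≠ 0) {a b : K} (ha : a ≠ 0) (hb : b ≠ 0) :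
    greenCoord d U V (a • z) (b • w) = greenCoord d U V z w := by
  have hdet : Matrix.det !![(a • z) 0, (a • z) 1; (b • w) 0, (b • w) 1] =
      a * b * Matrix.det !![z 0, z 1; w 0, w 1] := by
    simp only [Matrix.det_fin_two_of, Pi.smul_apply, smul_eq_mul]
    ring
  have ha' := norm_ne_zero_iff.mpr ha
  have hb' := norm_ne_zero_iff.mpr hb
  rw [greenCoord, greenCoord, hdet, escape_smul hd hC hs hz ha, escape_smul hd hC hs hw hb,
    norm_mul, norm_mul, Real.log_mul (mul_ne_zero ha' hb') (norm_ne_zero_iff.mpr hzw),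
    Real.log_mul ha' hb']
  ring

lemma green_mk_mk {d : ℕ} (hd : 2 ≤ d) {U V : MvPolynomial (Fin 2) K} {C : ℝ}
    (hC : ∀ z, z ≠ 0 → pairMap U V z ≠ 0 ∧ |Real.log ‖pairMap U V z‖ - d * Real.log ‖z‖| ≤ C)
    (hs : ∀ (a : K) z, pairMap U V (a • z) = a ^ d • pairMap U V z)
    {z w : Fin 2 → K} (hz : z ≠ 0) (hw : w ≠ 0)
    (h : Projectivization.mk K z hz ≠ Projectivization.mk K w hw) :
    green d U V (Projectivization.mk K z hz) (Projectivization.mk K w hw) =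
      greenCoord d U V z w := by
  obtain ⟨a, ha⟩ := Projectivization.exists_smul_eq_mk_rep K z hz
  obtain ⟨b, hb⟩ := Projectivization.exists_smul_eq_mk_rep K w hw
  rw [green, ← ha, ← hb]
  exact greenCoord_smul_smul hd hC hs hz hw (det_ne_zero_of_mk_ne hz hw h) a.ne_zero b.ne_zero

lemma det_rep_ne_zero {P Q : Projectivization K (Fin 2 → K)} (h : P ≠ Q) :
    Matrix.det !![P.rep 0, P.rep 1; Q.rep 0, Q.rep 1] ≠ 0 :=
  det_ne_zero_of_mk_ne P.rep_nonzero Q.rep_nonzero (by simpa only [Projectivization.mk_rep] using h)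

end Coordinates

/-! ### Passing from small families to large ones. -/

section Averaging

/-- Double counting: a pair of distinct indices survives the removal of any of the other `s.card -
2` elements. -/
lemma sum_sum_sum_erase {α : Type*} [DecidableEq α] (s : Finset α) (h : α → α → ℝ)
    (h0 : ∀ i, h i i = 0) :
    ∑ l ∈ s, ∑ i ∈ s.erase l, ∑ j ∈ s.erase l, h i j =
      ((s.card : ℝ) - 2) * ∑ i ∈ s, ∑ j ∈ s, h i j := by
  have h1 : ∀ l ∈ s, ∑ i ∈ s.erase l, ∑ j ∈ s.erase l, h i j =
      ∑ i ∈ s, ∑ j ∈ s, h i j - ∑ i ∈ s, h i l - ∑ j ∈ s, h l j := by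
    intro l hl
    simp only [Finset.sum_erase_eq_sub hl, Finset.sum_sub_distrib, h0]
    ring
  rw [Finset.sum_congr rfl h1, Finset.sum_sub_distrib, Finset.sum_sub_distrib, Finset.sum_const,
    nsmul_eq_mul, Finset.sum_comm (f := fun l i ↦ h i l)]
  ring

/-- A lower bound for the averages over all sets of `m` points passes to larger sets. -/
lemma le_sum_sum_of_card_le {α : Type*} [DecidableEq α] (h : α → α → ℝ) (h0 : ∀ i, h i i = 0)
    {m : ℕ} (hm : 2 ≤ m) (b : ℝ)
    (hb : ∀ s : Finset α, s.card = m → b * (m * (m - 1)) ≤ ∑ i ∈ s, ∑ j ∈ s, h i j)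
    {n : ℕ} (hn : m ≤ n) :
    ∀ s : Finset α, s.card = n → b * (n * (n - 1)) ≤ ∑ i ∈ s, ∑ j ∈ s, h i j := by
  induction n, hn using Nat.le_induction with
  | base => exact hb
  | succ n hmn ih =>
    intro s hs
    have hn2 : (2 : ℝ) ≤ n := by exact_mod_cast hm.trans hmn
    have h1 := sum_sum_sum_erase s h h0
    have h2 : ∑ _l ∈ s, b * ((n : ℝ) * (n - 1)) ≤
        ∑ l ∈ s, ∑ i ∈ s.erase l, ∑ j ∈ s.erase l, h i j :=
      Finset.sum_le_sum fun l hl ↦ ih _ (by rw [Finset.card_erase_of_mem hl, hs]; simp)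
    rw [h1, Finset.sum_const, nsmul_eq_mul, hs] at h2
    push_cast at h2 ⊢
    have h3 : ((n : ℝ) - 1) * (b * ((n + 1) * n)) ≤ (n - 1) * ∑ i ∈ s, ∑ j ∈ s, h i j := by
      linarith
    have := le_of_mul_le_mul_left h3 (by linarith)
    linarith

end Averaging

/-! ### Upper bounds for the determinant, and sums over ordered pairs. -/

section Bounds

variable {K : Type*} [NormedField K]

/-- The Leibniz formula serves all the fields at once; the loss `n!` is harmless because `log n! ≤ n
log n`. -/
lemma norm_det_le {n : ℕ} (A : Matrix (Fin n) (Fin n) K) (r : Fin n → ℝ)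
    (h : ∀ i j, ‖A i j‖ ≤ r i) : ‖A.det‖ ≤ n.factorial * ∏ i, r i := by
  rw [← Matrix.det_transpose, Matrix.det_apply]
  refine (norm_sum_le _ _).trans ?_
  calc ∑ σ : Equiv.Perm (Fin n), ‖Equiv.Perm.sign σ • ∏ i, A.transpose (σ i) i‖
      ≤ ∑ _σ : Equiv.Perm (Fin n), ∏ i, r i := by
        refine Finset.sum_le_sum fun σ _ ↦ ?_
        have : ‖Equiv.Perm.sign σ • ∏ i, A.transpose (σ i) i‖ = ∏ i, ‖A i (σ i)‖ := by
          rcases Int.units_eq_one_or (Equiv.Perm.sign σ) with h | h <;>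
            simp [h, Units.smul_def, norm_prod]
        rw [this]
        exact Finset.prod_le_prod (fun _ _ ↦ norm_nonneg _) fun i _ ↦ h i _
    _ = n.factorial * ∏ i, r i := by
        rw [Finset.sum_const, Finset.card_univ, Fintype.card_perm, Fintype.card_fin, nsmul_eq_mul]

/-- Each level `i < k` contributes `d - 1` coordinates of `φ^[i] z`, whatever the digits of `j`. The
main exponents sum to `∑ (d - 1) * d ^ i = d ^ k - 1`, and the error is `(d - 1) * C` per level. -/
lemma norm_iterateBasis_le {d : ℕ} (hd : 0 < d) (φ : (Fin 2 → K) → Fin 2 → K) (C : ℝ) (k : ℕ) :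
    ∀ (j : ℕ) (z : Fin 2 → K) (t : ℝ), (∀ i, ‖φ^[i] z‖ ≤ Real.exp ((d : ℝ) ^ i * t + C)) →
      ‖iterateBasis d φ k j z‖ ≤
        Real.exp (((d : ℝ) ^ k - 1) * t + k * (((d : ℝ) - 1) * C)) := by
  induction k with
  | zero => intro j z t _; simp [iterateBasis]
  | succ k ih =>
    intro j z t h
    have hz : ‖z‖ ≤ Real.exp (t + C) := by simpa using h 0
    have h1 := ih (j / d) (φ z) (d * t) fun i ↦ by
      rw [← Function.iterate_succ_apply, ← mul_assoc, ← pow_succ]; exact h (i + 1)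
    have hmod := Nat.mod_lt j hd
    rw [iterateBasis, norm_mul, norm_mul, norm_pow, norm_pow]
    calc ‖z 0‖ ^ (j % d) * ‖z 1‖ ^ (d - 1 - j % d) * ‖iterateBasis d φ k (j / d) (φ z)‖
        ≤ Real.exp (t + C) ^ (j % d) * Real.exp (t + C) ^ (d - 1 - j % d) *
          Real.exp (((d : ℝ) ^ k - 1) * (d * t) + k * (((d : ℝ) - 1) * C)) := by
          gcongr
          · exact (norm_le_pi_norm z 0).trans hz
          · exact (norm_le_pi_norm z 1).trans hz
      _ = _ := by
          rw [← pow_add, ← Real.exp_nat_mul, ← Real.exp_add,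
            show j % d + (d - 1 - j % d) = d - 1 by omega, Nat.cast_sub (by omega : 1 ≤ d)]
          congr 1
          push_cast
          ring

/-- Ordered pairs of distinct indices, for a symmetric summand. -/
lemma sum_sum_ne_eq_two_mul {n : ℕ} (h : Fin n → Fin n → ℝ) (hsymm : ∀ i j, h i j = h j i) :
    ∑ i, ∑ j with i ≠ j, h i j = 2 * ∑ i, ∑ j ∈ Finset.Ioi i, h i j := by
  have := Finset.sum_sum_Ioi_add_eq_sum_sum_off_diag (fun i j ↦ h i j)
  have e (i : Fin n) : (Finset.univ.filter fun j ↦ i ≠ j) = {i}ᶜ := by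
    ext j; simp [eq_comm]
  simp only [e]
  rw [Finset.mul_sum]
  calc ∑ i, ∑ j ∈ ({i}ᶜ : Finset (Fin n)), h i j = ∑ i, ∑ j ∈ ({i}ᶜ : Finset (Fin n)), h j i := by
        simp only [hsymm]
    _ = _ := by
      rw [← this]
      refine Finset.sum_congr rfl fun i _ ↦ ?_
      rw [Finset.mul_sum]
      refine Finset.sum_congr rfl fun j _ ↦ ?_
      rw [hsymm j i, two_mul]

lemma sum_sum_ne_add {n : ℕ} (a : Fin n → ℝ) :
    ∑ i, ∑ j with i ≠ j, (a i + a j) = 2 * ((n : ℝ) - 1) * ∑ i, a i := by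
  have e (i : Fin n) : ∑ j with i ≠ j, (a i + a j) = n * a i + ∑ j, a j - 2 * a i := by
    have : (Finset.univ.filter fun j ↦ i ≠ j) = Finset.univ.erase i := by
      ext j; simp [eq_comm]
    rw [this, Finset.sum_erase_eq_sub (Finset.mem_univ i), Finset.sum_add_distrib]
    simp
    ring
  simp only [e, Finset.sum_sub_distrib, Finset.sum_add_distrib, ← Finset.mul_sum]
  simp
  ring

lemma sum_sum_ne_const {n : ℕ} (a : ℝ) :
    ∑ i : Fin n, ∑ _j with i ≠ _j, a = n * ((n : ℝ) - 1) * a := by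
  have := sum_sum_ne_add (fun _ : Fin n ↦ a / 2)
  simp only [add_halves, Finset.sum_const, Finset.card_univ, Fintype.card_fin,
    nsmul_eq_mul] at this ⊢
  linarith

end Bounds

/-! ### Lower bounds for the averages of the Green function. -/

section LowerBound

lemma le_average_of_card_le {X : Type*} (g : X → X → ℝ) {m : ℕ} (hm : 2 ≤ m) (b : ℝ)
    (hb : ∀ P : Fin m → X, Function.Injective P →
      b * (m * (m - 1)) ≤ ∑ i, ∑ j with i ≠ j, g (P i) (P j))
    {n : ℕ} (hn : m ≤ n) (P : Fin n → X) (hP : Function.Injective P) :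
    b ≤ 1 / ((n : ℝ) * ((n : ℝ) - 1)) * ∑ i, ∑ j with i ≠ j, g (P i) (P j) := by
  have hn2 : (2 : ℝ) ≤ n := by exact_mod_cast hm.trans hn
  have key := le_sum_sum_of_card_le (fun i j : Fin n ↦ if i ≠ j then g (P i) (P j) else 0)
    (by simp) hm b (fun s hs ↦ ?_) hn Finset.univ (by simp)
  · simp only [← Finset.sum_filter] at key
    rw [one_div, inv_mul_eq_div, le_div_iff₀ (by nlinarith)]
    exact key
  · have := hb (fun i ↦ P (s.orderEmbOfFin hs i)) (hP.comp (s.orderEmbOfFin hs).injective)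
    refine this.trans_eq ?_
    have e (F : Fin n → ℝ) : ∑ i ∈ s, F i = ∑ i, F (s.orderEmbOfFin hs i) := by
      conv_lhs => rw [← Finset.image_orderEmbOfFin_univ s hs]
      exact Finset.sum_image ((s.orderEmbOfFin hs).injective.injOn)
    rw [e]
    refine Finset.sum_congr rfl fun i _ ↦ ?_
    rw [e, Finset.sum_filter]
    simp

lemma log_factorial_le (n : ℕ) : Real.log n.factorial ≤ n * Real.log n := by
  rw [← Real.log_pow]
  refine Real.log_le_log (by positivity) ?_
  exact_mod_cast Nat.factorial_le_pow n

variable {K : Type*} [NormedField K]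

/-- The determinant of `iterateBasis` at the `n` points is computed exactly by the Vandermonde
formula and bounded above by the escape function. Comparing logarithms bounds `∑ log |det|` over
pairs from above. -/
lemma le_sum_greenCoord {d : ℕ} (hd : 2 ≤ d) (f g : Polynomial K)
    (hf : f.natDegree ≤ d) (hg : g.natDegree ≤ d) (hfg : Polynomial.resultant f g d d ≠ 0) {C : ℝ}
    (hC : ∀ z, z ≠ 0 → pairMap (f.homogenize d) (g.homogenize d) z ≠ 0 ∧
      |Real.log ‖pairMap (f.homogenize d) (g.homogenize d) z‖ - d * Real.log ‖z‖| ≤ C)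
    (k : ℕ) {n : ℕ} (hn : n = d ^ k) (z : Fin n → Fin 2 → K) (hz : ∀ i, z i ≠ 0)
    (hzz : ∀ i j, i ≠ j → Matrix.det !![z i 0, z i 1; z j 0, z j 1] ≠ 0) :
    -(n * (2 * Real.log n + k * (2 * ((d : ℝ) - 1) * C +
        |Real.log ‖Polynomial.resultant f g d d‖|))) ≤
      ∑ i, ∑ j with i ≠ j, greenCoord d (f.homogenize d) (g.homogenize d) (z i) (z j) := by
  set φ := pairMap (f.homogenize d) (g.homogenize d) with hφ
  set r := Polynomial.resultant f g d d with hr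
  set Λ : Fin n → ℝ := fun i ↦ escape d (f.homogenize d) (g.homogenize d) (z i) with hΛ
  set L : Fin n → Fin n → ℝ :=
    fun i j ↦ Real.log ‖Matrix.det !![z i 0, z i 1; z j 0, z j 1]‖ with hL
  have h2 : (2 : ℝ) ≤ d := by exact_mod_cast hd
  have hnd : (n : ℝ) = (d : ℝ) ^ k := by rw [hn]; push_cast; rfl
  have hLsymm (i j) : L i j = L j i := by
    simp only [hL, Matrix.det_fin_two_of]
    rw [← norm_neg]
    congr 2
    ring
  have hdet := det_iterateBasis (by omega : 0 < d) f g hf hg φ (fun _ ↦ rfl) k hn z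
  have hprod : ∀ i, ∀ j ∈ Finset.Ioi i, ‖z j 0 * z i 1 - z i 0 * z j 1‖ =
      ‖Matrix.det !![z i 0, z i 1; z j 0, z j 1]‖ := by
    intro i j _
    rw [Matrix.det_fin_two_of, ← norm_neg]
    congr 1
    ring
  have hne : ∀ i, ∀ j ∈ Finset.Ioi i, ‖Matrix.det !![z i 0, z i 1; z j 0, z j 1]‖ ≠ 0 :=
    fun i j hj ↦ norm_ne_zero_iff.mpr (hzz i j (Finset.mem_Ioi.mp hj).ne)
  have hnorm : ‖(Matrix.of fun l j : Fin n ↦ iterateBasis d φ k j (z l)).det‖ =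
      ‖r‖ ^ resExponent d k *
        ∏ i, ∏ j ∈ Finset.Ioi i, ‖Matrix.det !![z i 0, z i 1; z j 0, z j 1]‖ := by
    rw [hdet, norm_mul, norm_pow, norm_prod]
    congr 1
    refine Finset.prod_congr rfl fun i _ ↦ ?_
    rw [norm_prod]
    exact Finset.prod_congr rfl (hprod i)
  have hr0 : ‖r‖ ≠ 0 := norm_ne_zero_iff.mpr hfg
  have hpp : ∏ i, ∏ j ∈ Finset.Ioi i, ‖Matrix.det !![z i 0, z i 1; z j 0, z j 1]‖ ≠ 0 :=
    Finset.prod_ne_zero_iff.mpr fun i _ ↦ Finset.prod_ne_zero_iff.mpr (hne i)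
  have hlog : Real.log ‖(Matrix.of fun l j : Fin n ↦ iterateBasis d φ k j (z l)).det‖ =
      resExponent d k * Real.log ‖r‖ + ∑ i, ∑ j ∈ Finset.Ioi i, L i j := by
    rw [hnorm, Real.log_mul (pow_ne_zero _ hr0) hpp, Real.log_pow, Real.log_prod
      fun i _ ↦ Finset.prod_ne_zero_iff.mpr (hne i)]
    congr 1
    exact Finset.sum_congr rfl fun i _ ↦ Real.log_prod (hne i)
  have hbasis (i j : Fin n) : ‖(Matrix.of fun l j : Fin n ↦ iterateBasis d φ k j (z l)) i j‖ ≤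
      Real.exp (((d : ℝ) ^ k - 1) * Λ i + k * (((d : ℝ) - 1) * C)) := by
    refine norm_iterateBasis_le (by omega) φ C k j (z i) (Λ i) fun l ↦ ?_
    have h1 := (abs_le.mp ((tendsto_escapeSeq hd hC (hz i)).2 l)).2
    have h0 := iterate_ne_zero (fun z hz ↦ (hC z hz).1) (hz i) l
    rw [← Real.log_le_iff_le_exp (norm_pos_iff.mpr h0)]
    linarith
  have hle := norm_det_le _ _ hbasis
  rw [← Real.exp_sum] at hle
  have hpos : 0 < ‖(Matrix.of fun l j : Fin n ↦ iterateBasis d φ k j (z l)).det‖ := by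
    rw [hnorm]
    exact lt_of_le_of_ne (by positivity) (mul_ne_zero (pow_ne_zero _ hr0) hpp).symm
  have hle' := Real.log_le_log hpos hle
  rw [Real.log_mul (by positivity) (Real.exp_ne_zero _), Real.log_exp, hlog,
    Finset.sum_add_distrib, ← Finset.mul_sum, Finset.sum_const, Finset.card_univ,
    Fintype.card_fin, nsmul_eq_mul, ← hnd] at hle'
  have hfac := log_factorial_le n
  have hexp := two_mul_resExponent hd k
  rw [← hnd] at hexp
  have hres : res d (f.homogenize d) (g.homogenize d) = r := by
    rw [res, Polynomial.aeval_homogenize_X_one f hf, Polynomial.aeval_homogenize_X_one g hg]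
  have hsum : ∑ i, ∑ j with i ≠ j,
      greenCoord d (f.homogenize d) (g.homogenize d) (z i) (z j) =
      -(2 * ∑ i, ∑ j ∈ Finset.Ioi i, L i j) + 2 * ((n : ℝ) - 1) * ∑ i, Λ i -
        n * ((n : ℝ) - 1) * (1 / ((d : ℝ) * (d - 1)) * Real.log ‖r‖) := by
    rw [← sum_sum_ne_eq_two_mul L hLsymm, ← sum_sum_ne_add, ← sum_sum_ne_const]
    simp only [← Finset.sum_neg_distrib, ← Finset.sum_add_distrib, ← Finset.sum_sub_distrib]
    refine Finset.sum_congr rfl fun i _ ↦ Finset.sum_congr rfl fun j _ ↦ ?_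
    simp only [greenCoord, hres, hL, hΛ]
    ring
  rw [hsum]
  -- The main part of the exponent cancels the resultant term of `hsum`; what is left is `n * k / d
  -- * log ‖r‖`, bounded in `e2`.
  have hmul := congrArg (· * Real.log ‖r‖) hexp
  simp only [sub_mul] at hmul
  have e1 : (n : ℝ) * (n - 1) * (1 / (d * (d - 1)) * Real.log ‖r‖) =
      n * (n - 1) / (d * (d - 1)) * Real.log ‖r‖ := by ring
  have e2 : (n : ℝ) * k / d * Real.log ‖r‖ ≤ n * (k * |Real.log ‖r‖|) := by
    calc (n : ℝ) * k / d * Real.log ‖r‖ ≤ n * k / d * |Real.log ‖r‖| := by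
          gcongr; exact le_abs_self _
      _ ≤ n * k * |Real.log ‖r‖| := by
          gcongr; exact div_le_self (by positivity) (by linarith)
      _ = _ := by ring
  rw [e1]
  linarith

/-- The escape estimate at `k = 0` gives `Λ(z) ≥ log ‖z‖ - C`, which offsets `|det| ≤ 2 ‖z‖ ‖w‖`.
This crude bound serves for `n < d`, where the largest power of `d` up to `n` is `1` and gives no
pairs. -/
lemma le_greenCoord {d : ℕ} (hd : 2 ≤ d) {U V : MvPolynomial (Fin 2) K} {C : ℝ}
    (hC : ∀ z, z ≠ 0 → pairMap U V z ≠ 0 ∧ |Real.log ‖pairMap U V z‖ - d * Real.log ‖z‖| ≤ C)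
    {z w : Fin 2 → K} (hz : z ≠ 0) (hw : w ≠ 0)
    (hzw : Matrix.det !![z 0, z 1; w 0, w 1] ≠ 0) :
    -(Real.log 2 + 2 * C + 1 / ((d : ℝ) * (d - 1)) * Real.log ‖res d U V‖) ≤
      greenCoord d U V z w := by
  have h1 := (abs_le.mp ((tendsto_escapeSeq hd hC hz).2 0)).2
  have h2 := (abs_le.mp ((tendsto_escapeSeq hd hC hw).2 0)).2
  simp only [Function.iterate_zero, id, pow_zero, one_mul] at h1 h2
  have hz' := norm_pos_iff.mpr hz
  have hw' := norm_pos_iff.mpr hw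
  have h3 : ‖Matrix.det !![z 0, z 1; w 0, w 1]‖ ≤ 2 * (‖z‖ * ‖w‖) := by
    rw [Matrix.det_fin_two_of]
    refine (norm_sub_le _ _).trans ?_
    rw [norm_mul, norm_mul, two_mul]
    gcongr <;> exact norm_le_pi_norm _ _
  have h4 := Real.log_le_log (norm_pos_iff.mpr hzw) h3
  rw [Real.log_mul two_ne_zero (by positivity), Real.log_mul hz'.ne' hw'.ne'] at h4
  rw [greenCoord]
  linarith

lemma half_le_log {n : ℕ} (hn : 2 ≤ n) : 1 / 2 ≤ Real.log n := by
  have h1 : Real.log 2 ≤ Real.log n := Real.log_le_log (by norm_num) (by exact_mod_cast hn)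
  have := Real.log_two_gt_d9
  linarith

lemma exists_le_avgGreen {d : ℕ} (hd : 2 ≤ d) (f g : Polynomial K)
    (hf : f.natDegree ≤ d) (hg : g.natDegree ≤ d) (hfg : Polynomial.resultant f g d d ≠ 0) :
    ∃ c : ℝ, ∀ n : ℕ, 2 ≤ n → ∀ P : Fin n → Projectivization K (Fin 2 → K),
      Function.Injective P →
      avgGreen d (f.homogenize d) (g.homogenize d) P ≥ -c * (Real.log n / n) := by
  obtain ⟨C, hC⟩ := exists_abs_log_norm_pairMap_sub_le (by omega : 0 < d) f g hf hg hfg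
  have h2 : (2 : ℝ) ≤ d := by exact_mod_cast hd
  have hC0 : 0 ≤ C := by
    have h1 : (fun _ ↦ 1 : Fin 2 → K) ≠ 0 := fun h ↦ one_ne_zero (congrFun h 0)
    exact (abs_nonneg _).trans (hC _ h1).2
  set D : ℝ := 2 * ((d : ℝ) - 1) * C + |Real.log ‖Polynomial.resultant f g d d‖| with hD
  have hD0 : 0 ≤ D := by
    have : 0 ≤ (d : ℝ) - 1 := by linarith
    positivity
  set b : ℝ := |Real.log 2 + 2 * C + 1 / ((d : ℝ) * (d - 1)) *
    Real.log ‖res d (f.homogenize d) (g.homogenize d)‖| with hb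
  have hb0 : 0 ≤ b := abs_nonneg _
  -- The summand `b` handles `n < d`, and `2 + 2 * D` comes from `k ≤ 2 log m` with `m = d ^ k`. The
  -- factor `2 * d` comes from `1 / (m - 1) ≤ 2 * d / n`, and for `n < d` from `log n ≥ 1 / 2`.
  refine ⟨2 * d * (2 + 2 * D + b), fun n hn P hP ↦ ?_⟩
  have hn2 : (2 : ℝ) ≤ n := by exact_mod_cast hn
  have hlogn := half_le_log hn
  rw [ge_iff_le, avgGreen]
  rcases lt_or_ge n d with hnd | hnd
  · refine le_trans ?_ (le_average_of_card_le (green d (f.homogenize d) (g.homogenize d)) le_rfl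
      (-b) (fun Q hQ ↦ ?_) hn P hP)
    · have hnd' : (n : ℝ) ≤ d := by exact_mod_cast hnd.le
      have h1 : 1 ≤ 2 * d * (Real.log n / n) := by
        rw [mul_div_assoc', le_div_iff₀ (by linarith)]
        nlinarith
      have h3 : b ≤ 2 * d * (2 + 2 * D + b) * (Real.log n / n) := by
        calc b ≤ (2 + 2 * D + b) * 1 := by linarith
          _ ≤ (2 + 2 * D + b) * (2 * d * (Real.log n / n)) := by gcongr
          _ = _ := by ring
      linarith
    · have := sum_sum_ne_const (n := 2) (-b)
      rw [mul_comm, ← this]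
      refine Finset.sum_le_sum fun i _ ↦ Finset.sum_le_sum fun j hj ↦ ?_
      have hij : Q i ≠ Q j := hQ.ne (Finset.mem_filter.mp hj).2
      refine le_trans (neg_le_neg (le_abs_self _)) (le_greenCoord hd hC (Q i).rep_nonzero
        (Q j).rep_nonzero (det_rep_ne_zero hij))
  · obtain ⟨k, hk⟩ : ∃ k, k = Nat.log d n := ⟨_, rfl⟩
    have hk1 : 1 ≤ k := hk ▸ Nat.log_pos (by omega) hnd
    have hkn : d ^ k ≤ n := hk ▸ Nat.pow_log_le_self d (by omega)
    have hnk : n < d ^ (k + 1) := hk ▸ Nat.lt_pow_succ_log_self (by omega) n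
    obtain ⟨m, hm⟩ : ∃ m, m = d ^ k := ⟨_, rfl⟩
    have hm2 : 2 ≤ m := hm ▸ hd.trans (Nat.le_self_pow (by omega) d)
    have hmR : (2 : ℝ) ≤ m := by exact_mod_cast hm2
    have hmn : m ≤ n := hm ▸ hkn
    have hmn' : (m : ℝ) ≤ n := by exact_mod_cast hmn
    have hndm : (n : ℝ) ≤ d * m := by
      rw [pow_succ, ← hm, mul_comm] at hnk
      exact_mod_cast hnk.le
    have hkm : (k : ℝ) ≤ 2 * Real.log m := by
      rw [hm]
      push_cast
      rw [Real.log_pow]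
      have := half_le_log hd
      nlinarith [(Nat.cast_nonneg k : (0 : ℝ) ≤ k)]
    have hlogm := half_le_log hm2
    have hlogmn : Real.log m ≤ Real.log n := Real.log_le_log (by linarith) hmn'
    refine le_trans ?_ (le_average_of_card_le (green d (f.homogenize d) (g.homogenize d)) hm2
      (-((2 + 2 * D) * Real.log m / (m - 1))) (fun Q hQ ↦ ?_) hmn P hP)
    · rw [neg_mul, neg_le_neg_iff]
      have h1 : 1 / ((m : ℝ) - 1) ≤ 2 * d / n := by
        rw [div_le_div_iff₀ (by linarith) (by linarith)]
        nlinarith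
      calc (2 + 2 * D) * Real.log m / (m - 1) = (2 + 2 * D) * Real.log m * (1 / (m - 1)) := by ring
        _ ≤ (2 + 2 * D + b) * Real.log n * (2 * d / n) := by
            have h3 : 0 ≤ 1 / ((m : ℝ) - 1) := one_div_nonneg.mpr (by linarith)
            have h4 : 0 ≤ (2 + 2 * D + b) * Real.log n := mul_nonneg (by linarith) (by linarith)
            exact mul_le_mul (mul_le_mul (by linarith) hlogmn (by linarith) (by linarith)) h1 h3 h4
        _ = _ := by ring
    · refine le_trans ?_ (le_sum_greenCoord hd f g hf hg hfg hC k hm (fun i ↦ (Q i).rep)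
        (fun i ↦ (Q i).rep_nonzero) fun i j hij ↦ det_rep_ne_zero (hQ.ne hij))
      have hm1 : (m : ℝ) - 1 ≠ 0 := by linarith
      have e : -((2 + 2 * D) * Real.log m / (m - 1)) * (m * (m - 1)) =
          -(m * (2 * Real.log m + 2 * Real.log m * D)) := by
        field_simp
      rw [e, neg_le_neg_iff]
      gcongr

end LowerBound

/-! ### Algebraic closedness, dehomogenization and the limit inferior. -/

lemma isAlgClosed_of_ringEquiv {K L : Type*} [Field K] [Field L] [IsAlgClosed L] (e : K ≃+* L) :
    IsAlgClosed K := by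
  refine IsAlgClosed.of_exists_root _ fun p _ hp ↦ ?_
  obtain ⟨x, hx⟩ := IsAlgClosed.exists_eval₂_eq_zero e.toRingHom p hp.degree_pos.ne'
  refine ⟨e.symm x, e.injective ?_⟩
  have := Polynomial.eval₂_at_apply e.toRingHom (p := p) (e.symm x)
  rw [map_zero, ← hx]
  simpa using this.symm

lemma isAlgClosed_of_isComplexOrPadic {K : Type*} [NormedField K] (hK : IsComplexOrPadic K) :
    IsAlgClosed K := by
  rcases hK with ⟨e, -⟩ | ⟨p, _, e, -⟩ <;> exact isAlgClosed_of_ringEquiv e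

lemma natDegree_aeval_X_one_le {K : Type*} [Field K] {d : ℕ} {U : MvPolynomial (Fin 2) K}
    (hU : U.IsHomogeneous d) :
    (MvPolynomial.aeval ![Polynomial.X, (1 : Polynomial K)] U).natDegree ≤ d := by
  rw [MvPolynomial.aeval_def, MvPolynomial.eval₂_eq']
  refine Polynomial.natDegree_sum_le_of_forall_le _ _ fun m hm ↦ ?_
  have hw : m 0 + m 1 = d := by
    have := hU (MvPolynomial.mem_support_iff.mp hm)
    simpa [Finsupp.weight_apply, Finsupp.sum_fintype, Fin.sum_univ_two] using this
  rw [← Polynomial.C_eq_algebraMap]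
  refine (Polynomial.natDegree_C_mul_le _ _).trans ?_
  simp [Fin.prod_univ_two]
  omega

lemma zero_le_liminf_of_ge {ι : ℕ → Type*} (F : (Σ n, ι n) → ℝ) (c : ℝ)
    (h : ∀ n, 2 ≤ n → ∀ P : ι n, F ⟨n, P⟩ ≥ -c * (Real.log n / n)) :
    (0 : EReal) ≤ liminf (fun P ↦ (F P : EReal)) (comap Sigma.fst atTop) := by
  have ht : Tendsto (fun n : ℕ ↦ -c * (Real.log n / n)) atTop (𝓝 0) := by
    have h1 : Tendsto (fun x : ℝ ↦ Real.log x / x) atTop (𝓝 0) :=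
      Real.isLittleO_log_id_atTop.tendsto_div_nhds_zero
    simpa using (h1.comp tendsto_natCast_atTop_atTop).const_mul (-c)
  have ht' : Tendsto (fun P : Σ n, ι n ↦ ((-c * (Real.log P.1 / P.1) : ℝ) : EReal))
      (comap Sigma.fst atTop) (𝓝 0) :=
    (continuous_coe_real_ereal.tendsto 0).comp (ht.comp tendsto_comap)
  -- The `ι n` may be empty for all large `n`; the filter is then trivial and the liminf is `⊤`.
  rcases eq_or_neBot (comap (Sigma.fst : (Σ n, ι n) → ℕ) atTop) with hbot | hbot
  · rw [hbot, liminf_bot]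
    exact le_top
  · rw [← ht'.liminf_eq]
    refine liminf_le_liminf ?_
    filter_upwards [tendsto_comap.eventually (eventually_ge_atTop 2)] with P hP
    exact EReal.coe_le_coe_iff.mpr (h P.1 hP P.2)

end DynGreen

theorem mainTheorem2 {K : Type*} [NormedField K] (hK : DynGreen.IsComplexOrPadic K)
    (d : ℕ) (hd : 2 ≤ d) (U V : MvPolynomial (Fin 2) K)
    (hU : U.IsHomogeneous d) (hV : V.IsHomogeneous d)
    (hUV : ∀ z : Fin 2 → K, MvPolynomial.eval z U = 0 → MvPolynomial.eval z V = 0 → z = 0) :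
    -- the limit defining the escape function exists at every nonzero vector
    (∀ z : Fin 2 → K, z ≠ 0 →
      Tendsto (DynGreen.escapeSeq d U V z) atTop (𝓝 (DynGreen.escape d U V z))) ∧
    -- the Green function does not depend on the choice of homogeneous coordinates
    (∀ (z w : Fin 2 → K) (hz : z ≠ 0) (hw : w ≠ 0),
      Projectivization.mk K z hz ≠ Projectivization.mk K w hw →
      DynGreen.green d U V (Projectivization.mk K z hz) (Projectivization.mk K w hw) =
        DynGreen.greenCoord d U V z w) ∧
    -- the lower bound for the averages
    (∃ c : ℝ, ∀ n : ℕ, 2 ≤ n → ∀ P : Fin n → Projectivization K (Fin 2 → K),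
      Function.Injective P →
      DynGreen.avgGreen d U V P ≥ -c * (Real.log n / n)) ∧
    -- the liminf over all families of `n` distinct points, as `n` tends to infinity
    (0 : EReal) ≤ liminf
      (fun P : (n : ℕ) × (Fin n ↪ Projectivization K (Fin 2 → K)) =>
        ((DynGreen.avgGreen d U V P.2 : ℝ) : EReal))
      (comap Sigma.fst atTop) := by
  have := DynGreen.isAlgClosed_of_isComplexOrPadic hK
  -- The forms are replaced by homogenizations of one-variable polynomials, whose degree may drop
  -- below `d`.
  obtain ⟨f, hfU⟩ : ∃ f, f = MvPolynomial.aeval ![Polynomial.X, (1 : Polynomial K)] U := ⟨_, rfl⟩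
  obtain ⟨g, hgV⟩ : ∃ g, g = MvPolynomial.aeval ![Polynomial.X, (1 : Polynomial K)] V := ⟨_, rfl⟩
  have hf : f.natDegree ≤ d := hfU ▸ DynGreen.natDegree_aeval_X_one_le hU
  have hg : g.natDegree ≤ d := hgV ▸ DynGreen.natDegree_aeval_X_one_le hV
  obtain rfl : f.homogenize d = U := Polynomial.homogenize_eq_of_isHomogeneous hU hfU.symm
  obtain rfl : g.homogenize d = V := Polynomial.homogenize_eq_of_isHomogeneous hV hgV.symm
  have hfg := DynGreen.resultant_ne_zero_of_homogenize f g hf hg hUV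
  obtain ⟨C, hC⟩ := DynGreen.exists_abs_log_norm_pairMap_sub_le (by omega) f g hf hg hfg
  obtain ⟨c, hc⟩ := DynGreen.exists_le_avgGreen hd f g hf hg hfg
  exact ⟨fun z hz ↦ (DynGreen.tendsto_escapeSeq hd hC hz).1,
    fun z w hz hw ↦ DynGreen.green_mk_mk hd hC (DynGreen.pairMap_homogenize_smul f g d) hz hw,
    ⟨c, hc⟩, DynGreen.zero_le_liminf_of_ge _ c fun n hn P ↦ hc n hn P P.injective⟩
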